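/- Let $\mathfrak g$ be a complex simple Lie algebra of type A-D-E (i.e. simply laced), let $\mathfrak h$ be a Cartan subalgebra, $\Delta\subset\mathfrak h'$ the set of roots, $\Delta_+$ a choice of positive roots, $\Pi=\{\alpha_i\mid i\in I\}$ the corresponding set of simple roots, and $\psi$ the highest root. Let $I=I_1\sqcup I_2$ be a partition (parts may be empty) such that, for $k=1,2$, the roots $\alpha_i,\alpha_j$ are orthogonal for all distinct $i,j\in I_k$, and such that $\alpha_i$ is orthogonal to $\psi$ for every $i\in I_2$. (Such a partition exists, and is then unique, exactly when $\mathfrak g$ is not of type $A_\ell$ with $\ell$ even, i.e. exactly when the Coxeter number of $\mathfrak g$ is even.) Let $s_i$ be the reflection in $\alpha_i$, let $\tau_k=\prod_{i\in I_k}s_i$ (a product of commuting reflections), and let $\sigma=\tau_2\tau_1$, a Coxeter element of the Weyl group. Let $Z$ be the cyclic group generated by $\sigma$, let $h$ be the Coxeter number, i.e. the order of $\sigma$, and put $g=h/2$. Put $\beta_i=\alpha_i$ if $i\in I_1$ and $\beta_i=-\alpha_i$ if $i\in I_2$, and let $(Z\cdot\beta_i)_+=\Delta_+\cap Z\cdot\beta_i$.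 Then for every $i\in I$ $$\operatorname{card}\,(Z\cdot\beta_i)_+=g,$$ and $\Delta_+$ is the disjoint union $$\Delta_+=\bigsqcup_{i\in I}(Z\cdot\beta_i)_+ .$$ -/

import Mathlib

noncomputable section

namespace RootPairing.Base

variable {ι R M N : Type*} [CommRing R] [AddCommGroup M] [Module R M] [AddCommGroup N] [Module R N]
  {P : RootPairing ι R M N} (b : P.Base)

/-- The set of positive roots `Δ₊`, i.e. the roots which are sums of simple roots. -/
def positiveRoots : Set M :=
  {φ | φ ∈ Set.range P.root ∧ φ ∈ AddSubmonoid.closure (P.root '' b.support)}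

/-- `ψ` is (the index of) the highest root: for every root `φ`, the difference `ψ - φ` is a sum of
simple roots. -/
def IsHighestRoot (ψ : ι) : Prop :=
  ∀ j, P.root ψ - P.root j ∈ AddSubmonoid.closure (P.root '' b.support)

/-- The partition `I = I₁ ⊔ I₂` of the index set of the simple roots relative to the highest
root `ψ`: within each part distinct simple roots are orthogonal, and the simple roots in `I₂` are
orthogonal to `ψ`. A part may be empty (this happens for rank one, where `I₂ = ∅`). For a simply
laced irreducible root system, such a partition exists exactly when the type is not `A_ℓ` with
`ℓ` even, i.e. exactly when the Coxeter number is even, and it is then unique. -/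
structure IsOrthogonalPartition (ψ : ι) (I₁ I₂ : Set b.support) : Prop where
  disjoint : Disjoint I₁ I₂
  union_eq : I₁ ∪ I₂ = Set.univ
  orthogonal₁ : I₁.Pairwise fun i j ↦ P.IsOrthogonal i j
  orthogonal₂ : I₂.Pairwise fun i j ↦ P.IsOrthogonal i j
  orthogonal_highest : ∀ i ∈ I₂, P.IsOrthogonal i ψ

variable {b}

open Classical in
/-- The product `τ` of the commuting simple reflections `s_i`, for `i` in a set `J` of pairwise
orthogonal simple roots, as an automorphism of the weight space. -/
def reflectionProd {J : Set b.support} (hJ : J.Pairwise fun i j ↦ P.IsOrthogonal i j) : M ≃ₗ[R] M :=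
  (Finset.univ.filter (· ∈ J)).noncommProd (fun i ↦ P.reflection i) fun i hi j hj hij ↦
    P.isOrthogonal_comm i j (hJ (by simpa using hi) (by simpa using hj) hij)

namespace IsOrthogonalPartition

variable {ψ : ι} {I₁ I₂ : Set b.support} (hI : b.IsOrthogonalPartition ψ I₁ I₂)

/-- The Coxeter element `σ = τ₂ τ₁`. -/
def coxeterElement : M ≃ₗ[R] M :=
  reflectionProd hI.orthogonal₂ * reflectionProd hI.orthogonal₁

/-- The Coxeter number `h`, i.e. the order of a Coxeter element (all Coxeter elements being
conjugate in the Weyl group, one may use `σ`). -/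
def coxeterNumber : ℕ := orderOf hI.coxeterElement

open Classical in
/-- The signed simple roots: `β_i = α_i` for `i ∈ I₁` and `β_i = -α_i` for `i ∈ I₂`. -/
def signedSimpleRoot (_ : b.IsOrthogonalPartition ψ I₁ I₂) (i : b.support) : M :=
  if i ∈ I₁ then P.root i else -P.root i

/-- The positive part `(Z · β_i)₊ = Δ₊ ∩ Z · β_i` of the orbit of `β_i` under the cyclic group
`Z` generated by the Coxeter element. -/
def positivePart (i : b.support) : Set M :=
  b.positiveRoots ∩ MulAction.orbit (Subgroup.zpowers hI.coxeterElement) (hI.signedSimpleRoot i)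

end IsOrthogonalPartition

end RootPairing.Base

end

/-!
The proof uses Coxeter's projection of the root system to a plane, on which the two involutions
`τ₁` and `τ₂` act as reflections and the Coxeter element `σ = τ₂ τ₁` acts as a rotation.

Let `C` be the Cartan matrix. Since `2 - C` is symmetric, nonnegative and irreducible, Perron's
theorem (`Matrix.IsSymm.exists_pos_eigenvector`) gives a positive eigenvector `x`, with eigenvalue
`c ≥ 0`. Pairing `x` with the highest root, which is dominant, shows `c < 2`, so `c = η + η⁻¹` for
some `η` of modulus one in the upper half-plane (`exists_isPerronVector`). Let `p` be the linear
functional with `p α_i = x_i` for `i ∈ I₁` and `p α_i = -x_i η` for `i ∈ I₂` (`planeMap`). The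
eigenvector equation says exactly that `p ∘ σ = η² p`. As `x` is positive, `p` maps all positive
roots strictly to one side of a line through the origin. This has the following consequences.

* The image of a `σ`-orbit of roots sums to zero, so the orbit contains roots of both signs, and at
  the point where the sign changes it passes through some `β_i`: a product of commuting simple
  reflections makes only the corresponding simple roots negative. Thus the orbits of the `β_i`
  cover the positive roots.
* If `η^(2k) = 1`, then `σ^k` preserves the positive roots, so it is trivial: this is simple
  transitivity of the Weyl group, proved by deleting letters from a word
  (`wordProd_eq_one_of_mapsTo`).
* The highest root `ψ` is fixed by `τ₂`, and `p ψ` is a real multiple of a power of `η`. Comparing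
  this with the action of `τ₂` on the plane gives `η^(2m) = -1` for some `m`
  (`exists_zpow_eq_neg_one`). This is where the Coxeter number is forced to be even. So `σ^m`
  exchanges positive and negative roots, and half of each orbit is positive.
* As `p β_i` is `x_i` or `x_i η`, an equation `σ^k β_i = β_j` forces `η^(2k) = 1` or
  `η^(2k ± 1) = 1`. The latter is incompatible with `η^(2m) = -1`, so `σ^k = 1` and `i = j`. Hence
  the orbits of the `β_i` are distinct and each has as many elements as the order of `σ`.
-/

/-! ### Perron's theorem for symmetric matrices -/

open Metric in
/-- Perron's theorem for a real symmetric matrix `A` with nonnegative entries: if the graph of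
nonzero entries of `A` is connected, there is an eigenvector with positive entries. -/
theorem Matrix.IsSymm.exists_pos_eigenvector {n : Type*} [Fintype n] [DecidableEq n] [Nonempty n]
    {A : Matrix n n ℝ} (hA : A.IsSymm) (hnonneg : ∀ i j, 0 ≤ A i j)
    (hconn : ∀ (s : n → Prop) (i j : n), s i → (∀ i j, s i → A i j ≠ 0 → s j) → s j) :
    ∃ (x : n → ℝ) (c : ℝ), (∀ i, 0 < x i) ∧ 0 ≤ c ∧ ∀ i, ∑ j, A i j * x j = c * x i := by
  set T := Matrix.toEuclideanCLM (n := n) (𝕜 := ℝ) A with hT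
  have hself : IsSelfAdjoint T := by
    rw [IsSelfAdjoint, hT, ← map_star, Matrix.star_eq_conjTranspose,
      Matrix.conjTranspose_eq_transpose_of_trivial, hA]
  have hQ (x : EuclideanSpace ℝ n) : T.reApplyInnerSelf x = ∑ i, ∑ j, A i j * x j * x i := by
    simp [ContinuousLinearMap.reApplyInnerSelf_apply, PiLp.inner_apply, hT,
      Matrix.mulVec, dotProduct, Finset.mul_sum, mul_comm, mul_left_comm]
  obtain ⟨x₀, hx₀, hmax⟩ := (isCompact_sphere (0 : EuclideanSpace ℝ n) 1).exists_isMaxOn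
    (NormedSpace.sphere_nonempty.mpr zero_le_one) T.reApplyInnerSelf_continuous.continuousOn
  -- The Rayleigh quotient does not decrease when the entries are replaced by absolute values.
  set y : EuclideanSpace ℝ n := WithLp.toLp 2 fun i ↦ |x₀ i| with hy
  have hynorm : ‖y‖ = 1 := by
    have : ‖y‖ = ‖x₀‖ := by simp [EuclideanSpace.norm_eq, hy]
    rw [this]; simpa using hx₀
  have hymax : IsMaxOn T.reApplyInnerSelf (sphere 0 ‖y‖) y := by
    rw [hynorm]
    intro z hz
    refine le_trans (b := T.reApplyInnerSelf x₀) (hmax hz) ?_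
    simp only [hQ]
    refine Finset.sum_le_sum fun i _ ↦ Finset.sum_le_sum fun j _ ↦ ?_
    rw [mul_assoc, mul_assoc]
    refine mul_le_mul_of_nonneg_left ?_ (hnonneg i j)
    simpa [hy, abs_mul] using le_abs_self (x₀ j * x₀ i)
  have hy0 : y ≠ 0 := by rintro h; simp [h] at hynorm
  obtain ⟨c, hc⟩ : ∃ c : ℝ, T y = c • y :=
    ⟨_, (hself.hasEigenvector_of_isMaxOn hy0 hymax).apply_eq_smul⟩
  replace hc (i : n) : ∑ j, A i j * y j = c * y i := by
    have := congrArg (fun v : EuclideanSpace ℝ n ↦ v i) hc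
    simpa [hT, Matrix.mulVec, dotProduct] using this
  have hy_nonneg (i : n) : 0 ≤ y i := by simp [hy]
  obtain ⟨k, hk⟩ : ∃ k, y k ≠ 0 := by
    by_contra! h
    exact hy0 (by ext i; simpa using h i)
  have hpos (i : n) : 0 < y i := by
    refine (hy_nonneg i).lt_of_ne' (hconn (fun i ↦ y i ≠ 0) k i hk fun i j hi hij hj ↦ ?_)
    -- If `y j = 0` then `∑ l, A j l * y l = 0`, so every summand vanishes.
    have h0 := hc j
    rw [hj, mul_zero, Finset.sum_eq_zero_iff_of_nonneg
      fun l _ ↦ mul_nonneg (hnonneg _ _) (hy_nonneg _)] at h0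
    have := h0 i (Finset.mem_univ i)
    rw [← hA.apply i j] at hij
    exact (mul_ne_zero hij hi) this
  refine ⟨y, c, hpos, ?_, hc⟩
  have := hc k
  by_contra! hneg
  have h1 : c * y k < 0 := mul_neg_of_neg_of_pos hneg (hpos k)
  have h2 : 0 ≤ ∑ j, A k j * y j :=
    Finset.sum_nonneg fun l _ ↦ mul_nonneg (hnonneg _ _) (hy_nonneg _)
  linarith

/-! ### Positive roots and words in the simple reflections -/

namespace RootPairing.Base

section PositiveRoots

variable {ι R M N : Type*} [CommRing R]
  [AddCommGroup M] [Module R M] [AddCommGroup N] [Module R N]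
  {P : RootPairing ι R M N} {b : P.Base}

section CharZero

variable [CharZero R]

lemma root_mem_positiveRoots_iff {i : ι} : P.root i ∈ b.positiveRoots ↔ b.IsPos i := by
  have key {i : ι} (h : P.root i ∈ AddSubmonoid.closure (P.root '' b.support)) : b.IsPos i := by
    suffices ∀ m ∈ AddSubmonoid.closure (P.root '' b.support),
        ∃ f : ι → ℕ, m = ∑ j ∈ b.support, f j • P.root j by
      obtain ⟨f, hf⟩ := this _ h
      rw [isPos_iff', b.height_eq_sum (f := fun j ↦ (f j : ℤ)) (by simpa using hf)]
      positivity
    classical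
    intro m hm
    induction hm using AddSubmonoid.closure_induction with
    | mem x hx =>
      obtain ⟨j, hj, rfl⟩ := hx
      refine ⟨Pi.single j 1, ?_⟩
      rw [Finset.sum_eq_single_of_mem j hj (by simp_all)]
      simp
    | zero => exact ⟨0, by simp⟩
    | add x y _ _ hx hy =>
      obtain ⟨f, hf⟩ := hx
      obtain ⟨g, hg⟩ := hy
      exact ⟨f + g, by simp [hf, hg, add_smul, Finset.sum_add_distrib]⟩
  refine ⟨fun h ↦ key h.2, fun h ↦ ⟨⟨i, rfl⟩, ?_⟩⟩
  refine (b.root_mem_or_neg_mem i).resolve_right fun h' ↦ ?_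
  let _ := P.indexNeg
  exact (IsPos.neg_iff_not b i).mp (key (by simpa using h')) h

lemma neg_mem_positiveRoots_iff {φ : M} (hφ : φ ∈ Set.range P.root) :
    -φ ∈ b.positiveRoots ↔ φ ∉ b.positiveRoots := by
  obtain ⟨i, rfl⟩ := hφ
  let _ := P.indexNeg
  have : -P.root i = P.root (-i) := by simp
  rw [this, root_mem_positiveRoots_iff, root_mem_positiveRoots_iff, IsPos.neg_iff_not]

end CharZero

lemma root_mem_positiveRoots (i : b.support) : P.root i ∈ b.positiveRoots :=
  ⟨⟨i, rfl⟩, AddSubmonoid.subset_closure ⟨i, i.2, rfl⟩⟩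

/-- The element of the Weyl group represented by a word in the simple reflections. -/
def wordProd (l : List b.support) : M ≃ₗ[R] M :=
  (l.map fun i : b.support ↦ P.reflection i).prod

@[simp] lemma wordProd_nil : wordProd ([] : List b.support) = 1 := by simp [wordProd]

@[simp] lemma wordProd_cons (i : b.support) (l : List b.support) :
    wordProd (i :: l) = P.reflection i * wordProd l := by simp [wordProd]

@[simp] lemma wordProd_append (l l' : List b.support) :
    wordProd (l ++ l') = wordProd l * wordProd l' := by simp [wordProd]

lemma wordProd_inv (l : List b.support) : (wordProd l)⁻¹ = wordProd l.reverse := by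
  simp [wordProd, List.prod_inv_reverse, Function.comp_def]

lemma wordProd_mem_range_root (l : List b.support) {φ : M} (hφ : φ ∈ Set.range P.root) :
    wordProd l φ ∈ Set.range P.root := by
  induction l with
  | nil => simpa using hφ
  | cons i l ih => exact (P.bijOn_reflection_root i).mapsTo ih

lemma reflection_mul_wordProd {l : List b.support} {i j : ι}
    (hij : wordProd l (P.root i) = P.root j) :
    P.reflection j * wordProd l = wordProd l * P.reflection i := by
  induction l generalizing j with
  | nil => simp_all
  | cons k l ih =>
    simp only [wordProd_cons, LinearEquiv.mul_apply] at hij ⊢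
    have h := ih (j := P.reflectionPerm k j) (by rw [root_reflectionPerm, ← hij, reflection_same])
    rw [reflection_reflectionPerm] at h
    rw [mul_assoc, ← h]
    simp only [← mul_assoc]
    rw [← sq, P.reflection_sq, one_mul]

variable [CharZero R] [Finite ι] [IsDomain R] [P.IsCrystallographic] [P.IsReduced]

/-- A simple reflection permutes the positive roots other than the simple root itself. -/
lemma reflection_mem_positiveRoots (i : b.support) {φ : M} (hφ : φ ∈ b.positiveRoots)
    (hne : φ ≠ P.root i) : P.reflection i φ ∈ b.positiveRoots := by
  obtain ⟨j, rfl⟩ := hφ.1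
  rw [root_mem_positiveRoots_iff] at hφ
  rw [← P.root_reflectionPerm, root_mem_positiveRoots_iff]
  exact hφ.reflectionPerm i.2 fun h ↦ hne (by rw [h])

/-- If a word in the simple reflections makes a positive root negative, then at some stage the
root has been moved to the simple root whose reflection is applied next. -/
lemma exists_wordProd_apply_eq_root {φ : M} (hφ : φ ∈ b.positiveRoots) (l : List b.support)
    (hl : wordProd l φ ∉ b.positiveRoots) :
    ∃ (l₁ l₂ : List b.support) (i : b.support), l = l₁ ++ i :: l₂ ∧
      wordProd l₂ φ = P.root i := by
  induction l with
  | nil => simp [hφ] at hl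
  | cons i l ih =>
    by_cases h : wordProd l φ ∈ b.positiveRoots
    · refine ⟨[], l, i, rfl, ?_⟩
      by_contra hne
      exact hl (by simpa using reflection_mem_positiveRoots i h hne)
    · obtain ⟨l₁, l₂, j, rfl, hj⟩ := ih h
      exact ⟨i :: l₁, l₂, j, rfl, hj⟩

/-- An element of the Weyl group preserving the positive roots is trivial: a word for it that ends
in `s_i` must send `α_i` to a simple root at some stage, so that two letters can be deleted. -/
lemma wordProd_eq_one_of_mapsTo (l : List b.support)
    (hpos : Set.MapsTo (wordProd l) b.positiveRoots b.positiveRoots) : wordProd l = 1 := by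
  induction hn : l.length using Nat.strong_induction_on generalizing l with
  | _ n ih =>
  rcases l.eq_nil_or_concat with rfl | ⟨l, i, rfl⟩
  · simp
  rw [List.concat_eq_append] at hn hpos ⊢
  have hneg : wordProd l (P.root i) ∉ b.positiveRoots := by
    have h := hpos (root_mem_positiveRoots i)
    intro h'
    exact (neg_mem_positiveRoots_iff h'.1).mp (by simpa using h) h'
  obtain ⟨l₁, l₂, j, rfl, hj⟩ := exists_wordProd_apply_eq_root (root_mem_positiveRoots i) l hneg
  have heq : wordProd ((l₁ ++ j :: l₂) ++ [i]) = wordProd (l₁ ++ l₂) := by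
    simp only [wordProd_append, wordProd_cons, wordProd_nil, mul_one]
    rw [reflection_mul_wordProd hj, mul_assoc, mul_assoc, ← sq, P.reflection_sq, mul_one]
  rw [heq] at hpos ⊢
  exact ih _ (by simp [← hn]) _ hpos rfl

end PositiveRoots

section ReflectionProd

variable {ι R M N : Type*} [CommRing R]
  [AddCommGroup M] [Module R M] [AddCommGroup N] [Module R N]
  {P : RootPairing ι R M N} {b : P.Base}
  {J : Set b.support} (hJ : J.Pairwise fun i j ↦ P.IsOrthogonal i j)

open Classical in
lemma reflectionProd_eq_wordProd :
    reflectionProd hJ = wordProd (Finset.univ.filter (· ∈ J)).toList := by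
  rw [wordProd, ← Finset.noncommProd_toFinset _ _ _ (Finset.nodup_toList _)]
  exact Finset.noncommProd_congr (Finset.toList_toFinset _).symm (fun _ _ ↦ rfl) _

include hJ in
lemma wordProd_apply_of_orthogonal {l : List b.support} (hl : l.Nodup) (hlJ : ∀ i ∈ l, i ∈ J)
    (v : M) :
    wordProd l v = v - (l.map fun j : b.support ↦ P.coroot' j v • P.root j).sum := by
  induction l with
  | nil => simp
  | cons i l ih =>
    simp only [List.nodup_cons, List.mem_cons, forall_eq_or_imp] at hl hlJ
    -- `s_i` fixes the correction term, which lies in the span of roots orthogonal to `α_i`.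
    have hfix : P.coroot' i (l.map fun j : b.support ↦ P.coroot' j v • P.root j).sum = 0 := by
      rw [map_list_sum, List.sum_eq_zero]
      simp only [List.map_map, List.mem_map]
      rintro _ ⟨j, hj, rfl⟩
      have hij : P.pairing j i = 0 :=
        (hJ (hlJ.2 j hj) hlJ.1 fun h ↦ hl.1 (h ▸ hj)).1
      simp [hij]
    rw [wordProd_cons, LinearEquiv.mul_apply, ih hl.2 hlJ.2, reflection_apply, map_sub, hfix,
      sub_zero, List.map_cons, List.sum_cons]
    abel

open Classical in
lemma reflectionProd_apply (v : M) :
    reflectionProd hJ v = v - ∑ j with j ∈ J, P.coroot' j v • P.root j := by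
  rw [reflectionProd_eq_wordProd, wordProd_apply_of_orthogonal hJ (Finset.nodup_toList _) (by simp),
    Finset.sum_map_toList]

/-- The only positive roots made negative by a product of commuting simple reflections are the
simple roots involved. -/
lemma exists_eq_root_of_reflectionProd [CharZero R] [Finite ι] [IsDomain R] [P.IsCrystallographic]
    [P.IsReduced] {φ : M} (hφ : φ ∈ b.positiveRoots) (h : reflectionProd hJ φ ∉ b.positiveRoots) :
    ∃ i ∈ J, φ = P.root i := by
  classical
  rw [reflectionProd_eq_wordProd] at h
  set l := (Finset.univ.filter (· ∈ J)).toList with hl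
  have hlJ : ∀ i ∈ l, i ∈ J := by simp [hl]
  have hnodup : l.Nodup := Finset.nodup_toList _
  obtain ⟨l₁, l₂, i, hl', hi⟩ := exists_wordProd_apply_eq_root hφ l h
  rw [hl'] at hlJ hnodup
  have hiJ := hlJ i (by simp)
  refine ⟨i, hiJ, (wordProd l₂).injective ?_⟩
  have hnodup' := hnodup.of_append_right
  rw [List.nodup_cons] at hnodup'
  have hJ₂ : ∀ j ∈ l₂, j ∈ J := fun j hj ↦ hlJ j (by simp [hj])
  rw [hi, wordProd_apply_of_orthogonal hJ hnodup'.2 hJ₂, List.sum_eq_zero, sub_zero]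
  simp only [List.mem_map]
  rintro _ ⟨j, hj, rfl⟩
  have hij : P.pairing i j = 0 := (hJ hiJ (hJ₂ j hj) fun h ↦ hnodup'.1 (h ▸ hj)).1
  simp [hij]

lemma reflectionProd_root_of_mem {i : b.support} (hi : i ∈ J) :
    reflectionProd hJ (P.root i) = -P.root i := by
  classical
  rw [reflectionProd_apply, Finset.sum_eq_single_of_mem i (by simpa)]
  · simp [two_smul]
  · intro j hj hji
    have : P.pairing i j = 0 := (hJ hi (by simpa using hj) hji.symm).1
    simp [this]

lemma reflectionProd_reflectionProd (v : M) : reflectionProd hJ (reflectionProd hJ v) = v := by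
  classical
  nth_rw 2 [reflectionProd_apply]
  have h : ∀ j ∈ Finset.univ.filter (· ∈ J), reflectionProd hJ (P.coroot' j v • P.root j) =
      -(P.coroot' j v • P.root j) := fun j hj ↦ by
    rw [map_smul, reflectionProd_root_of_mem hJ (by simpa using hj), smul_neg]
  rw [map_sub, map_sum, Finset.sum_congr rfl h, reflectionProd_apply, Finset.sum_neg_distrib]
  abel

end ReflectionProd

end RootPairing.Base

/-! ### The Coxeter plane -/

noncomputable section

namespace RootPairing.Base

variable {ι M N : Type*} [AddCommGroup M] [Module ℂ M] [AddCommGroup N] [Module ℂ N]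
  {P : RootPairing ι ℂ M N}

/-- `x` is a positive eigenvector of the Cartan matrix for the eigenvalue `2 - η - η⁻¹`, where `η`
is a complex number of modulus one in the upper half-plane, i.e. `η = exp (i θ)` with
`0 < θ < π`. -/
structure IsPerronVector (b : P.Base) (x : b.support → ℝ) (η : ℂ) : Prop where
  pos : ∀ i, 0 < x i
  norm_eq : ‖η‖ = 1
  im_pos : 0 < η.im
  eigen : ∀ i : b.support, ∑ j : b.support, P.pairing i j * (x j : ℂ) = (2 - η - η⁻¹) * x i

lemma exists_isPerronVector [Finite ι] [P.IsRootSystem] [P.IsCrystallographic] [P.IsReduced]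
    [P.IsIrreducible] {b : P.Base} (hb : b.cartanMatrix.IsSimplyLaced) {ψ : ι}
    (hψ : b.IsHighestRoot ψ) : ∃ x η, b.IsPerronVector x η := by
  classical
  have hne : Nonempty b.support := by
    have : Nonempty ι := ⟨ψ⟩
    exact b.support_nonempty.to_subtype
  have hsymm (i j : b.support) : b.cartanMatrix i j = b.cartanMatrix j i := by
    rcases eq_or_ne i j with rfl | hij
    · rfl
    have h := b.cartanMatrix_apply_eq_zero_iff_symm (i := i) (j := j)
    rcases hb hij with h1 | h1 <;> rcases hb hij.symm with h2 | h2 <;> simp_all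
  let A : Matrix b.support b.support ℝ :=
    .of fun i j ↦ ((if i = j then 2 else 0) - b.cartanMatrix i j : ℤ)
  have hA : A.IsSymm := by
    ext i j
    simp [A, hsymm i j, eq_comm]
  obtain ⟨x, c, hx, hc, hAx⟩ := hA.exists_pos_eigenvector
    (fun i j ↦ by
      rcases eq_or_ne i j with rfl | hij
      · simp [A]
      · simpa [A, hij] using b.cartanMatrix_le_zero_of_ne i j hij)
    (fun s i j hi hs ↦ b.induction_on_cartanMatrix s hi fun k l hk hkl ↦ by
      rcases eq_or_ne k l with rfl | hne
      · exact hk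
      · exact hs k l hk (by
          rw [hsymm] at hkl
          simpa [A, hne] using hkl))
  have hpair (i j : b.support) : P.pairing i j = (b.cartanMatrix i j : ℂ) := by
    simpa using (b.algebraMap_cartanMatrixIn_apply ℤ i j).symm
  have hCx (i : b.support) : ∑ j : b.support, P.pairing i j * (x j : ℂ) = (2 - c) * x i := by
    have h := hAx i
    simp only [A, Matrix.of_apply, Int.cast_sub, sub_mul, Finset.sum_sub_distrib, Int.cast_ite,
      ite_mul, Int.cast_zero, zero_mul, Finset.sum_ite_eq, Finset.mem_univ, if_true] at h
    replace h : ∑ j, (b.cartanMatrix i j : ℝ) * x j = (2 - c) * x i := by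
      push_cast at h; linarith
    simp_rw [hpair]
    exact_mod_cast h
  -- Pairing with the highest root, which is dominant, shows that the eigenvalue `2 - c` of the
  -- Cartan matrix is positive.
  have hc2 : c < 2 := by
    have hnat (m : M) (hm : m ∈ AddSubmonoid.closure (P.root '' b.support)) :
        ∃ n : b.support → ℕ, ∀ i, b.toWeightBasis.repr m i = n i := by
      induction hm using AddSubmonoid.closure_induction with
      | mem y hy =>
        obtain ⟨j, hj, rfl⟩ := hy
        refine ⟨Pi.single ⟨j, hj⟩ 1, fun i ↦ ?_⟩
        have := b.toWeightBasis_repr_root ⟨j, hj⟩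
        rw [this]
        simp [Finsupp.single_apply, Pi.single_apply, eq_comm]
      | zero => exact ⟨0, by simp⟩
      | add y z _ _ hy hz =>
        obtain ⟨n, hn⟩ := hy
        obtain ⟨n', hn'⟩ := hz
        exact ⟨n + n', fun i ↦ by simp [hn, hn']⟩
    have hdom (i : b.support) : ∃ n : ℕ, P.pairing ψ i = n := by
      obtain ⟨n, hn⟩ := hnat _ (hψ (P.reflectionPerm i ψ))
      refine ⟨n i, ?_⟩
      rw [← hn i, root_reflectionPerm, reflection_apply_root, sub_sub_cancel, map_smul,
        b.toWeightBasis_repr_root]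
      simp
    choose d hd using hdom
    obtain ⟨k, hk⟩ : ∃ k, d k ≠ 0 := by
      obtain ⟨j, hj, hj'⟩ := b.exists_mem_support_pos_pairingIn_ne_zero ψ
      refine ⟨⟨j, hj⟩, fun h ↦ hj' ?_⟩
      have h0 : P.pairing ψ j = 0 := by simpa [h] using hd ⟨j, hj⟩
      rw [P.pairing_eq_zero_iff'] at h0
      apply FaithfulSMul.algebraMap_injective ℤ ℂ
      rw [algebraMap_pairingIn, h0, map_zero]
    obtain ⟨r, hr⟩ := hnat _ (hψ (P.reflectionPerm ψ ψ))
    let f : M →ₗ[ℂ] ℂ := b.toWeightBasis.constr ℂ fun i ↦ (x i : ℂ)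
    let g : M →ₗ[ℂ] ℂ := ∑ j : b.support, (x j : ℂ) • P.coroot' j
    have hfg : g = (2 - c : ℂ) • f := by
      refine b.toWeightBasis.ext fun i ↦ ?_
      have h1 : f (P.root i) = x i := by
        rw [← b.toWeightBasis_apply, Module.Basis.constr_basis]
      rw [b.toWeightBasis_apply, LinearMap.smul_apply, h1, smul_eq_mul, ← hCx]
      simp [g, mul_comm]
    have hgψ : g (P.root ψ) = (∑ j, x j * d j : ℝ) := by simp [g, hd]
    have hfψ : 2 * f (P.root ψ) = (∑ j, r j * x j : ℝ) := by
      have h2 : P.root ψ - P.root (P.reflectionPerm ψ ψ) = (2 : ℂ) • P.root ψ := by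
        simp [two_smul]
      rw [h2] at hr
      rw [← smul_eq_mul, ← map_smul, Module.Basis.constr_apply_fintype]
      simp only [Module.Basis.equivFun_apply, hr, smul_eq_mul]
      push_cast
      rfl
    have h3 : 2 * (∑ j, x j * d j) = (2 - c) * ∑ j, r j * x j := by
      have : 2 * g (P.root ψ) = (2 - c) * (2 * f (P.root ψ)) := by
        rw [hfg]; simp; ring
      rw [hgψ, hfψ] at this
      exact_mod_cast this
    have h4 : 0 < ∑ j, x j * d j :=
      Finset.sum_pos' (fun j _ ↦ mul_nonneg (hx j).le (Nat.cast_nonneg _))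
        ⟨k, Finset.mem_univ k, mul_pos (hx k) (by positivity)⟩
    have h5 : 0 ≤ ∑ j, r j * x j :=
      Finset.sum_nonneg fun j _ ↦ mul_nonneg (Nat.cast_nonneg _) (hx j).le
    by_contra! h6
    nlinarith
  -- Hence `c = 2 cos θ` with `0 < θ < π`.
  set s := √(1 - (c / 2) ^ 2) with hs
  have hs2 : s ^ 2 = 1 - (c / 2) ^ 2 := Real.sq_sqrt (by nlinarith)
  have hs0 : 0 < s := Real.sqrt_pos.mpr (by nlinarith)
  let η : ℂ := ⟨c / 2, s⟩
  have hnorm : ‖η‖ = 1 := by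
    rw [Complex.norm_def, Complex.normSq_mk, Real.sqrt_eq_one]
    linarith
  refine ⟨x, η, hx, hnorm, hs0, fun i ↦ ?_⟩
  rw [hCx, Complex.inv_eq_conj hnorm]
  congr 1
  apply Complex.ext
  · simp [η]; ring
  · simp [η]

namespace IsOrthogonalPartition

variable {b : P.Base} {ψ : ι} {I₁ I₂ : Set b.support} (hI : b.IsOrthogonalPartition ψ I₁ I₂)
  {x : b.support → ℝ} {η : ℂ}

include hI in
lemma mem_or_mem (i : b.support) : i ∈ I₁ ∨ i ∈ I₂ := by
  have : i ∈ I₁ ∪ I₂ := hI.union_eq ▸ Set.mem_univ i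
  exact this

include hI in
lemma mem₂_iff {i : b.support} : i ∈ I₂ ↔ i ∉ I₁ :=
  ⟨fun h₂ h₁ ↦ Set.disjoint_left.mp hI.disjoint h₁ h₂, (hI.mem_or_mem i).resolve_left⟩

include hI in
open Classical in
lemma sum_pairing_mul₁ (hx : b.IsPerronVector x η) {i : b.support} (hi : i ∈ I₂) :
    ∑ j with j ∈ I₁, P.pairing i j * (x j : ℂ) = -(η + η⁻¹) * x i := by
  have h := hx.eigen i
  rw [← Finset.sum_filter_add_sum_filter_not _ (· ∈ I₁),
    Finset.sum_eq_single_of_mem (s := Finset.univ.filter (· ∉ I₁)) i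
      (by simpa using hI.mem₂_iff.mp hi)] at h
  · rw [P.pairing_same] at h
    linear_combination h
  · intro j hj hji
    have : P.pairing i j = 0 :=
      (hI.orthogonal₂ hi (hI.mem₂_iff.mpr (by simpa using hj)) hji.symm).1
    simp [this]

include hI in
open Classical in
lemma sum_pairing_mul₂ (hx : b.IsPerronVector x η) {i : b.support} (hi : i ∈ I₁) :
    ∑ j with j ∈ I₂, P.pairing i j * (x j : ℂ) = -(η + η⁻¹) * x i := by
  have h := hx.eigen i
  rw [← Finset.sum_filter_add_sum_filter_not _ (· ∈ I₂),
    Finset.sum_eq_single_of_mem (s := Finset.univ.filter (· ∉ I₂)) i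
      (by simpa [hI.mem₂_iff] using hi)] at h
  · rw [P.pairing_same] at h
    linear_combination h
  · intro j hj hji
    have : P.pairing i j = 0 :=
      (hI.orthogonal₁ hi (by simpa [hI.mem₂_iff] using hj) hji.symm).1
    simp [this]

variable [P.IsRootSystem]

open Classical in
/-- The projection of the weight space to the Coxeter plane, identified with `ℂ`. The simple roots
in `I₁` go to the positive real axis, those in `I₂` to the ray spanned by `-η`. The Coxeter
element acts on the plane as multiplication by `η ^ 2`, see `planeMap_coxeterElement`. -/
def planeMap (_ : b.IsOrthogonalPartition ψ I₁ I₂) (x : b.support → ℝ) (η : ℂ) : M →ₗ[ℂ] ℂ :=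
  b.toWeightBasis.constr ℂ fun i ↦ if i ∈ I₁ then (x i : ℂ) else -(x i * η)

lemma planeMap_root₁ {x : b.support → ℝ} {η : ℂ} {i : b.support} (hi : i ∈ I₁) :
    hI.planeMap x η (P.root i) = x i := by
  rw [← b.toWeightBasis_apply, planeMap, Module.Basis.constr_basis, if_pos hi]

lemma planeMap_root₂ {x : b.support → ℝ} {η : ℂ} {i : b.support} (hi : i ∈ I₂) :
    hI.planeMap x η (P.root i) = -(x i * η) := by
  rw [← b.toWeightBasis_apply, planeMap, Module.Basis.constr_basis, if_neg (hI.mem₂_iff.mp hi)]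

lemma planeMap_reflectionProd₁ (hx : b.IsPerronVector x η) (v : M) :
    hI.planeMap x η (reflectionProd hI.orthogonal₁ v) = -hI.planeMap x η⁻¹ v := by
  classical
  suffices hI.planeMap x η ∘ₗ (reflectionProd hI.orthogonal₁).toLinearMap =
      -hI.planeMap x η⁻¹ from LinearMap.congr_fun this v
  refine b.toWeightBasis.ext fun i ↦ ?_
  simp only [toWeightBasis_apply, LinearMap.comp_apply, LinearEquiv.coe_coe, LinearMap.neg_apply]
  rcases hI.mem_or_mem i with hi | hi
  · rw [reflectionProd_root_of_mem _ hi, map_neg, hI.planeMap_root₁ hi, hI.planeMap_root₁ hi]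
  · have h : ∑ j with j ∈ I₁, hI.planeMap x η (P.coroot' j (P.root i) • P.root j) =
        -(η + η⁻¹) * x i := by
      rw [← hI.sum_pairing_mul₁ hx hi]
      refine Finset.sum_congr rfl fun j hj ↦ ?_
      rw [map_smul, hI.planeMap_root₁ (by simpa using hj)]
      simp
    rw [reflectionProd_apply, map_sub, map_sum, h, hI.planeMap_root₂ hi, hI.planeMap_root₂ hi]
    ring

lemma planeMap_reflectionProd₂ (hx : b.IsPerronVector x η) (v : M) :
    hI.planeMap x η (reflectionProd hI.orthogonal₂ v) = -η ^ 2 * hI.planeMap x η⁻¹ v := by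
  classical
  have hη : η ≠ 0 := by rintro rfl; simpa using hx.norm_eq
  suffices hI.planeMap x η ∘ₗ (reflectionProd hI.orthogonal₂).toLinearMap =
      (-η ^ 2) • hI.planeMap x η⁻¹ from LinearMap.congr_fun this v
  refine b.toWeightBasis.ext fun i ↦ ?_
  simp only [toWeightBasis_apply, LinearMap.comp_apply, LinearEquiv.coe_coe, LinearMap.smul_apply,
    smul_eq_mul]
  rcases hI.mem_or_mem i with hi | hi
  · have h : ∑ j with j ∈ I₂, hI.planeMap x η (P.coroot' j (P.root i) • P.root j) =
        -η * (-(η + η⁻¹) * x i) := by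
      rw [← hI.sum_pairing_mul₂ hx hi, Finset.mul_sum]
      refine Finset.sum_congr rfl fun j hj ↦ ?_
      rw [map_smul, hI.planeMap_root₂ (by simpa using hj)]
      simp
      ring
    rw [reflectionProd_apply, map_sub, map_sum, h, hI.planeMap_root₁ hi, hI.planeMap_root₁ hi]
    field_simp
    ring
  · rw [reflectionProd_root_of_mem _ hi, map_neg, hI.planeMap_root₂ hi, hI.planeMap_root₂ hi]
    field_simp

/-- The Coxeter element acts on the Coxeter plane as multiplication by `η ^ 2`. -/
lemma planeMap_coxeterElement (hx : b.IsPerronVector x η) (v : M) :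
    hI.planeMap x η (hI.coxeterElement v) = η ^ 2 * hI.planeMap x η v := by
  have h := hI.planeMap_reflectionProd₁ hx (reflectionProd hI.orthogonal₁ v)
  rw [reflectionProd_reflectionProd] at h
  rw [coxeterElement, LinearEquiv.mul_apply, hI.planeMap_reflectionProd₂ hx, h]
  ring

end IsOrthogonalPartition

end RootPairing.Base

end

/-! ### Orbits of the Coxeter element -/

namespace RootPairing.Base.IsOrthogonalPartition

variable {ι M N : Type*} [AddCommGroup M] [Module ℂ M] [AddCommGroup N] [Module ℂ N]
  {P : RootPairing ι ℂ M N} {b : P.Base} {ψ : ι} {I₁ I₂ : Set b.support}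
  (hI : b.IsOrthogonalPartition ψ I₁ I₂) {x : b.support → ℝ} {η : ℂ}

lemma exists_wordProd_eq_zpow (k : ℤ) :
    ∃ l : List b.support, hI.coxeterElement ^ k = wordProd l := by
  have hnat (n : ℕ) : ∃ l : List b.support, hI.coxeterElement ^ n = wordProd l := by
    induction n with
    | zero => exact ⟨[], by simp⟩
    | succ n ih =>
      obtain ⟨l, hl⟩ := ih
      have h : ∃ l' : List b.support, hI.coxeterElement = wordProd l' := by
        rw [coxeterElement, reflectionProd_eq_wordProd, reflectionProd_eq_wordProd,
          ← wordProd_append]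
        exact ⟨_, rfl⟩
      obtain ⟨l', hl'⟩ := h
      exact ⟨l ++ l', by rw [pow_succ, hl, wordProd_append, ← hl']⟩
  obtain ⟨n, rfl | rfl⟩ := k.eq_nat_or_neg
  · exact_mod_cast hnat n
  · obtain ⟨l, hl⟩ := hnat n
    exact ⟨l.reverse, by rw [zpow_neg, zpow_natCast, hl, wordProd_inv]⟩

lemma zpow_apply_mem_range_root (k : ℤ) {φ : M} (hφ : φ ∈ Set.range P.root) :
    (hI.coxeterElement ^ k) φ ∈ Set.range P.root := by
  obtain ⟨l, hl⟩ := hI.exists_wordProd_eq_zpow k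
  exact hl ▸ wordProd_mem_range_root l hφ

lemma signedSimpleRoot_mem_range_root (i : b.support) :
    hI.signedSimpleRoot i ∈ Set.range P.root := by
  let _ := P.indexNeg
  rw [signedSimpleRoot]
  split_ifs
  · exact ⟨i, rfl⟩
  · exact ⟨-i, by simp⟩

lemma mem_orbit_zpowers_iff {φ χ : M} :
    φ ∈ MulAction.orbit (Subgroup.zpowers hI.coxeterElement) χ ↔
      ∃ k : ℤ, (hI.coxeterElement ^ k) χ = φ := by
  constructor
  · rintro ⟨⟨_, k, rfl⟩, rfl⟩
    exact ⟨k, rfl⟩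
  · rintro ⟨k, rfl⟩
    exact ⟨⟨_, k, rfl⟩, rfl⟩

/-- If the Coxeter element makes a positive root negative, then this step passes through a signed
simple root. -/
lemma exists_signedSimpleRoot_of_coxeterElement [Finite ι] [P.IsCrystallographic] [P.IsReduced]
    {φ : M} (hφ : φ ∈ b.positiveRoots) (h : hI.coxeterElement φ ∉ b.positiveRoots) :
    ∃ i, hI.signedSimpleRoot i = φ ∨ hI.signedSimpleRoot i = hI.coxeterElement φ := by
  rw [coxeterElement, LinearEquiv.mul_apply] at h ⊢
  by_cases h₁ : reflectionProd hI.orthogonal₁ φ ∈ b.positiveRoots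
  · obtain ⟨i, hi, hi'⟩ := exists_eq_root_of_reflectionProd hI.orthogonal₂ h₁ h
    refine ⟨i, Or.inr ?_⟩
    rw [hi', reflectionProd_root_of_mem _ hi, signedSimpleRoot, if_neg (hI.mem₂_iff.mp hi)]
  · obtain ⟨i, hi, rfl⟩ := exists_eq_root_of_reflectionProd hI.orthogonal₁ hφ h₁
    exact ⟨i, Or.inl (by rw [signedSimpleRoot, if_pos hi])⟩

lemma reflectionProd_highest : reflectionProd hI.orthogonal₂ (P.root ψ) = P.root ψ := by
  classical
  rw [reflectionProd_apply, Finset.sum_eq_zero, sub_zero]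
  intro j hj
  have : P.pairing ψ j = 0 := (hI.orthogonal_highest j (by simpa using hj)).2
  simp [this]

variable [P.IsRootSystem]

lemma planeMap_zpow (hx : b.IsPerronVector x η) (k : ℤ) (v : M) :
    hI.planeMap x η ((hI.coxeterElement ^ k) v) = η ^ (2 * k) * hI.planeMap x η v := by
  have hη : η ≠ 0 := by rintro rfl; simpa using hx.norm_eq
  induction k generalizing v with
  | zero => simp
  | succ n ih =>
    rw [zpow_add_one, LinearEquiv.mul_apply, ih, hI.planeMap_coxeterElement hx, mul_add,
      zpow_add₀ hη]
    norm_cast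
    ring
  | pred n ih =>
    have h := hI.planeMap_coxeterElement hx ((hI.coxeterElement ^ (-1 : ℤ)) v)
    rw [← LinearEquiv.mul_apply, zpow_neg_one, mul_inv_cancel, LinearEquiv.coe_one, id] at h
    rw [zpow_sub_one, LinearEquiv.mul_apply, ih, h, mul_sub, zpow_sub₀ hη]
    field_simp
    norm_cast

open Classical in
lemma planeMap_signedSimpleRoot (i : b.support) :
    hI.planeMap x η (hI.signedSimpleRoot i) = x i * η ^ (if i ∈ I₁ then 0 else 1 : ℤ) := by
  rw [signedSimpleRoot]
  split_ifs with hi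
  · simp [hI.planeMap_root₁ hi]
  · simp [hI.planeMap_root₂ (hI.mem₂_iff.mpr hi)]

/-- Positive roots map to the closed sector of the Coxeter plane between the rays spanned by `1`
and `-η`, so that they are all on the same side of a line. Multiplication by `1 + η⁻¹` turns this
sector into one inside the open lower half-plane. -/
lemma im_planeMap_neg_of_mem_positiveRoots (hx : b.IsPerronVector x η) {φ : M}
    (hφ : φ ∈ b.positiveRoots) : ((1 + η⁻¹) * hI.planeMap x η φ).im < 0 := by
  suffices φ = 0 ∨ ((1 + η⁻¹) * hI.planeMap x η φ).im < 0 by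
    refine this.resolve_left ?_
    rintro rfl
    obtain ⟨i, hi⟩ := hφ.1
    exact P.ne_zero i hi
  have hη : η ≠ 0 := by rintro rfl; simpa using hx.norm_eq
  obtain ⟨-, hφ⟩ := hφ
  induction hφ using AddSubmonoid.closure_induction with
  | mem y hy =>
    right
    obtain ⟨i, hi, rfl⟩ := hy
    have := mul_pos (hx.pos ⟨i, hi⟩) hx.im_pos
    rcases hI.mem_or_mem ⟨i, hi⟩ with h | h
    · rw [hI.planeMap_root₁ h, Complex.inv_eq_conj hx.norm_eq]
      simp
      linarith
    · rw [hI.planeMap_root₂ h]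
      have h2 : (1 + η⁻¹) * -(x ⟨i, hi⟩ * η) = -(x ⟨i, hi⟩ * (η + 1)) := by field_simp
      rw [h2]
      simpa using this
  | zero => exact Or.inl rfl
  | add y z _ _ hy hz =>
    rcases hy with rfl | hy <;> rcases hz with rfl | hz
    · simp
    · simpa using Or.inr hz
    · simpa using Or.inr hy
    · right
      rw [map_add, mul_add, Complex.add_im]
      linarith

lemma mem_positiveRoots_iff_im_planeMap (hx : b.IsPerronVector x η) {φ : M}
    (hφ : φ ∈ Set.range P.root) :
    φ ∈ b.positiveRoots ↔ ((1 + η⁻¹) * hI.planeMap x η φ).im < 0 := by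
  refine ⟨hI.im_planeMap_neg_of_mem_positiveRoots hx, fun h ↦ ?_⟩
  by_contra hφ'
  have := hI.im_planeMap_neg_of_mem_positiveRoots hx ((neg_mem_positiveRoots_iff hφ).mpr hφ')
  rw [map_neg, mul_neg, Complex.neg_im] at this
  linarith

lemma planeMap_ne_zero (hx : b.IsPerronVector x η) {φ : M} (hφ : φ ∈ Set.range P.root) :
    hI.planeMap x η φ ≠ 0 := by
  intro h
  by_cases hφ' : φ ∈ b.positiveRoots
  · simpa [h] using hI.im_planeMap_neg_of_mem_positiveRoots hx hφ'
  · simpa [h] using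
      hI.im_planeMap_neg_of_mem_positiveRoots hx ((neg_mem_positiveRoots_iff hφ).mpr hφ')

/-- A power of the Coxeter element acting as `-1` on the Coxeter plane exchanges positive and
negative roots. -/
lemma zpow_apply_mem_positiveRoots_iff (hx : b.IsPerronVector x η) {m : ℤ}
    (hm : η ^ (2 * m) = -1) {φ : M} (hφ : φ ∈ Set.range P.root) :
    (hI.coxeterElement ^ m) φ ∈ b.positiveRoots ↔ φ ∉ b.positiveRoots := by
  have hneg : -φ ∈ Set.range P.root := (P.neg_mem_range_root_iff).mpr hφ
  rw [← neg_mem_positiveRoots_iff hφ, hI.mem_positiveRoots_iff_im_planeMap hx hneg,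
    hI.mem_positiveRoots_iff_im_planeMap hx (hI.zpow_apply_mem_range_root m hφ),
    hI.planeMap_zpow hx, hm, map_neg, neg_one_mul]

variable [Finite ι] [P.IsCrystallographic] [P.IsReduced]

/-- The group generated by the Coxeter element acts faithfully on the Coxeter plane: a power acting
trivially there preserves the positive roots. -/
lemma zpow_eq_one (hx : b.IsPerronVector x η) {k : ℤ} (hk : η ^ (2 * k) = 1) :
    hI.coxeterElement ^ k = 1 := by
  obtain ⟨l, hl⟩ := hI.exists_wordProd_eq_zpow k
  rw [hl]
  refine wordProd_eq_one_of_mapsTo l fun φ hφ ↦ ?_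
  rw [← hl, hI.mem_positiveRoots_iff_im_planeMap hx (hI.zpow_apply_mem_range_root k hφ.1),
    hI.planeMap_zpow hx, hk, one_mul]
  exact hI.im_planeMap_neg_of_mem_positiveRoots hx hφ

omit [P.IsCrystallographic] [P.IsReduced] in
/-- Every orbit of the Coxeter element meets the negative roots: the images in the Coxeter plane of
the elements of an orbit sum to zero, hence are not all on the same side of a line. -/
lemma exists_pow_apply_notMem_positiveRoots (hx : b.IsPerronVector x η) {φ : M}
    (hφ : φ ∈ Set.range P.root) : ∃ n : ℕ, (hI.coxeterElement ^ n) φ ∉ b.positiveRoots := by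
  by_contra! hpos
  have hη : η ≠ 0 := by rintro rfl; simpa using hx.norm_eq
  have him (n : ℕ) : (η ^ (2 * n) * ((1 + η⁻¹) * hI.planeMap x η φ)).im < 0 := by
    have h := hI.im_planeMap_neg_of_mem_positiveRoots hx (hpos n)
    have h' := hI.planeMap_zpow hx n φ
    rw [zpow_natCast] at h'
    rw [h', mul_left_comm] at h
    exact_mod_cast h
  obtain ⟨m, n, hmn, heq⟩ : ∃ m n : ℕ, m < n ∧
      (hI.coxeterElement ^ m) φ = (hI.coxeterElement ^ n) φ := by
    obtain ⟨m, n, hne, heq⟩ := Finite.exists_ne_map_eq_of_infinite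
      fun n : ℕ ↦ (⟨_, (hpos n).1⟩ : Set.range P.root)
    rw [Subtype.mk.injEq] at heq
    rcases hne.lt_or_gt with h | h
    · exact ⟨m, n, h, heq⟩
    · exact ⟨n, m, h, heq.symm⟩
  obtain ⟨d, rfl⟩ := Nat.exists_eq_add_of_lt hmn
  have hone : (η ^ 2) ^ (d + 1) = 1 := by
    have h := congrArg (hI.planeMap x η) heq
    rw [← zpow_natCast, ← zpow_natCast, hI.planeMap_zpow hx, hI.planeMap_zpow hx] at h
    have h' := mul_right_cancel₀ (hI.planeMap_ne_zero hx hφ) h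
    have h3 : η ^ (2 * m) * (η ^ 2) ^ (d + 1) = η ^ (2 * m) * 1 := by
      rw [mul_one, ← pow_mul, ← pow_add]
      have : 2 * m + 2 * (d + 1) = 2 * (m + d + 1) := by ring
      rw [this]
      exact_mod_cast h'.symm
    exact mul_left_cancel₀ (pow_ne_zero _ hη) h3
  have hne : η ^ 2 ≠ 1 := by
    intro h
    rcases mul_self_eq_one_iff.mp (sq η ▸ h) with rfl | rfl <;> simpa using hx.im_pos
  have hsum : ∑ k ∈ Finset.range (d + 1), η ^ (2 * k) * ((1 + η⁻¹) * hI.planeMap x η φ) = 0 := by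
    simp_rw [← Finset.sum_mul, pow_mul, geom_sum_eq hne, hone]
    simp
  have hlt : (∑ k ∈ Finset.range (d + 1),
      η ^ (2 * k) * ((1 + η⁻¹) * hI.planeMap x η φ)).im < 0 := by
    rw [Complex.im_sum]
    exact Finset.sum_neg (fun k _ ↦ him k) ⟨0, by simp⟩
  rw [hsum] at hlt
  simp at hlt

lemma exists_zpow_signedSimpleRoot_eq (hx : b.IsPerronVector x η) {φ : M}
    (hφ : φ ∈ b.positiveRoots) :
    ∃ (i : b.support) (k : ℤ), (hI.coxeterElement ^ k) (hI.signedSimpleRoot i) = φ := by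
  classical
  have h := hI.exists_pow_apply_notMem_positiveRoots hx hφ.1
  obtain ⟨n, hn⟩ : ∃ n, Nat.find h = n + 1 :=
    Nat.exists_eq_succ_of_ne_zero fun h0 ↦ by
      have := Nat.find_spec h
      rw [h0] at this
      exact this (by simpa using hφ)
  have hlast := Nat.find_spec h
  have hprev : (hI.coxeterElement ^ n) φ ∈ b.positiveRoots := by
    simpa using Nat.find_min h (m := n) (by omega)
  rw [hn, pow_succ', LinearEquiv.mul_apply] at hlast
  obtain ⟨i, hi | hi⟩ := hI.exists_signedSimpleRoot_of_coxeterElement hprev hlast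
  · refine ⟨i, -n, ?_⟩
    rw [hi, ← zpow_natCast, ← LinearEquiv.mul_apply, ← zpow_add]
    simp
  · refine ⟨i, -(n + 1 : ℕ), ?_⟩
    rw [hi, ← LinearEquiv.mul_apply hI.coxeterElement, ← pow_succ', ← zpow_natCast,
      ← LinearEquiv.mul_apply, ← zpow_add]
    simp

lemma eq_and_zpow_eq_one_of_zpow_signedSimpleRoot_eq (hx : b.IsPerronVector x η) {m : ℤ}
    (hm : η ^ (2 * m) = -1) {i j : b.support} {k : ℤ}
    (h : (hI.coxeterElement ^ k) (hI.signedSimpleRoot i) = hI.signedSimpleRoot j) :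
    i = j ∧ hI.coxeterElement ^ k = 1 := by
  classical
  have hη : η ≠ 0 := by rintro rfl; simpa using hx.norm_eq
  have hplane := congrArg (hI.planeMap x η) h
  rw [hI.planeMap_zpow hx, hI.planeMap_signedSimpleRoot, hI.planeMap_signedSimpleRoot] at hplane
  have hxij : x i = x j := by
    have := congrArg norm hplane
    simpa only [norm_mul, norm_zpow, hx.norm_eq, one_zpow, one_mul, mul_one, Complex.norm_real,
      Real.norm_of_nonneg (hx.pos _).le] using this
  set e : ℤ := if i ∈ I₁ then 0 else 1 with he
  set e' : ℤ := if j ∈ I₁ then 0 else 1 with he'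
  have hpow : η ^ (2 * k + e - e') = 1 := by
    have hxj : (x j : ℂ) ≠ 0 := by exact_mod_cast (hx.pos j).ne'
    rw [hxij] at hplane
    rw [zpow_sub₀ hη, zpow_add₀ hη, div_eq_one_iff_eq (zpow_ne_zero _ hη)]
    exact mul_left_cancel₀ hxj (by linear_combination hplane)
  -- No odd power of `η` is trivial, since some even power is `-1`.
  have hodd (n : ℤ) (hn : Odd n) : η ^ n ≠ 1 := by
    intro h1
    have h2 : (η ^ (2 * m)) ^ n = 1 := by rw [zpow_comm, h1, one_zpow]
    rw [hm, hn.neg_one_zpow] at h2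
    norm_num at h2
  have hee : e = e' := by
    by_contra hne
    refine hodd _ ?_ hpow
    rw [he, he'] at hne ⊢
    split_ifs at hne ⊢
    · exact absurd rfl hne
    · exact ⟨k - 1, by ring⟩
    · exact ⟨k, by ring⟩
    · exact absurd rfl hne
  have hone : hI.coxeterElement ^ k = 1 := by
    refine hI.zpow_eq_one hx ?_
    rwa [hee, add_sub_cancel_right] at hpow
  refine ⟨?_, hone⟩
  rw [hone, LinearEquiv.coe_one, id] at h
  simp only [signedSimpleRoot] at h
  rw [he, he'] at hee
  split_ifs at h hee with h1 h2 h2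
  · exact Subtype.ext (P.root.injective h)
  · simp at hee
  · simp at hee
  · exact Subtype.ext (P.root.injective (neg_injective h))

omit [Finite ι] [P.IsCrystallographic] [P.IsReduced] in
lemma planeMap_inv (hx : b.IsPerronVector x η) {φ : M} (hφ : φ ∈ b.positiveRoots) :
    hI.planeMap x η⁻¹ φ = (starRingEnd ℂ) (hI.planeMap x η φ) := by
  obtain ⟨-, hφ⟩ := hφ
  induction hφ using AddSubmonoid.closure_induction with
  | mem y hy =>
    obtain ⟨i, hi, rfl⟩ := hy
    rcases hI.mem_or_mem ⟨i, hi⟩ with h | h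
    · rw [hI.planeMap_root₁ h, hI.planeMap_root₁ h, Complex.conj_ofReal]
    · rw [hI.planeMap_root₂ h, hI.planeMap_root₂ h, Complex.inv_eq_conj hx.norm_eq]
      simp
  | zero => simp
  | add y z _ _ hy hz => rw [map_add, map_add, map_add, hy, hz]

include hI in
/-- The Coxeter element has a power acting as `-1` on the Coxeter plane. The highest root lies, up
to sign, in the orbit of a signed simple root, hence maps to a real multiple of a power of `η`.
Being fixed by `τ₂`, it also lies on the mirror of `τ₂` in the plane. -/
lemma exists_zpow_eq_neg_one (hx : b.IsPerronVector x η) : ∃ m : ℤ, η ^ (2 * m) = -1 := by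
  classical
  have hη : η ≠ 0 := by rintro rfl; simpa using hx.norm_eq
  obtain ⟨φ, hφ, hfix⟩ : ∃ φ ∈ b.positiveRoots, reflectionProd hI.orthogonal₂ φ = φ := by
    by_cases hψ : P.root ψ ∈ b.positiveRoots
    · exact ⟨_, hψ, hI.reflectionProd_highest⟩
    · exact ⟨_, (neg_mem_positiveRoots_iff ⟨ψ, rfl⟩).mpr hψ, by
        rw [map_neg, hI.reflectionProd_highest]⟩
  obtain ⟨i, k, hk⟩ := hI.exists_zpow_signedSimpleRoot_eq hx hφ
  have hmirror := hI.planeMap_reflectionProd₂ hx φ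
  rw [hfix, hI.planeMap_inv hx hφ, ← hk, hI.planeMap_zpow hx, hI.planeMap_signedSimpleRoot]
    at hmirror
  set e : ℤ := if i ∈ I₁ then 0 else 1
  refine ⟨2 * k + e - 1, ?_⟩
  have hxi : (x i : ℂ) ≠ 0 := by exact_mod_cast (hx.pos i).ne'
  have hconj : (starRingEnd ℂ) η = η⁻¹ := (Complex.inv_eq_conj hx.norm_eq).symm
  simp only [map_mul, map_zpow₀, Complex.conj_ofReal, hconj] at hmirror
  have h1 : η ^ (2 * k + e) = -η ^ 2 * (η⁻¹) ^ (2 * k + e) := by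
    rw [zpow_add₀ hη, zpow_add₀ (inv_ne_zero hη)]
    exact mul_left_cancel₀ hxi (by linear_combination hmirror)
  have h2 : η ^ (2 * (2 * k + e - 1)) = η ^ (2 * k + e) * η ^ (2 * k + e) * (η ^ 2)⁻¹ := by
    rw [← zpow_add₀ hη, ← zpow_natCast, ← zpow_neg, ← zpow_add₀ hη]
    congr 1
    push_cast
    ring
  rw [h2]
  nth_rw 1 [h1]
  rw [inv_zpow]
  have := zpow_ne_zero (2 * k + e) hη
  field_simp

/-- Half of each orbit of a signed simple root is positive. -/
lemma two_mul_ncard_positivePart (hx : b.IsPerronVector x η) (i : b.support) :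
    2 * (hI.positivePart i).ncard = hI.coxeterNumber := by
  obtain ⟨m, hm⟩ := hI.exists_zpow_eq_neg_one hx
  set O := MulAction.orbit (Subgroup.zpowers hI.coxeterElement) (hI.signedSimpleRoot i) with hO
  have hroot : ∀ φ ∈ O, φ ∈ Set.range P.root := by
    intro φ hφ
    obtain ⟨k, rfl⟩ := hI.mem_orbit_zpowers_iff.mp hφ
    exact hI.zpow_apply_mem_range_root k (hI.signedSimpleRoot_mem_range_root i)
  have hzpow (k : ℤ) {φ : M} (hφ : φ ∈ O) : (hI.coxeterElement ^ k) φ ∈ O := by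
    obtain ⟨l, rfl⟩ := hI.mem_orbit_zpowers_iff.mp hφ
    exact hI.mem_orbit_zpowers_iff.mpr ⟨k + l, by rw [zpow_add, LinearEquiv.mul_apply]⟩
  have hfin : O.Finite := (Set.finite_range P.root).subset hroot
  have hcard : O.ncard = hI.coxeterNumber := by
    rw [coxeterNumber, ← Nat.card_zpowers, ← Nat.card_coe_set_eq]
    refine (Nat.card_congr (Equiv.ofBijective
      (fun g ↦ (⟨g • hI.signedSimpleRoot i, g, rfl⟩ : O)) ⟨?_, ?_⟩)).symm
    · rintro ⟨_, k, rfl⟩ ⟨_, l, rfl⟩ h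
      replace h : (hI.coxeterElement ^ k) (hI.signedSimpleRoot i) =
        (hI.coxeterElement ^ l) (hI.signedSimpleRoot i) := congrArg Subtype.val h
      have h' : (hI.coxeterElement ^ (-l + k)) (hI.signedSimpleRoot i) = hI.signedSimpleRoot i := by
        rw [zpow_add, LinearEquiv.mul_apply, h, ← LinearEquiv.mul_apply, ← zpow_add]
        simp
      have h1 := (hI.eq_and_zpow_eq_one_of_zpow_signedSimpleRoot_eq hx hm h').2
      rw [zpow_add, zpow_neg, inv_mul_eq_one] at h1
      exact Subtype.ext h1.symm
    · rintro ⟨_, g, rfl⟩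
      exact ⟨g, rfl⟩
  have himage : (hI.coxeterElement ^ m) '' hI.positivePart i = O \ hI.positivePart i := by
    ext φ
    constructor
    · rintro ⟨χ, ⟨hχ, hχO⟩, rfl⟩
      exact ⟨hzpow m hχO, fun h ↦
        (hI.zpow_apply_mem_positiveRoots_iff hx hm (hroot χ hχO)).mp h.1 hχ⟩
    · rintro ⟨hφO, hφ⟩
      have hinv : (hI.coxeterElement ^ m) ((hI.coxeterElement ^ (-m)) φ) = φ := by
        rw [← LinearEquiv.mul_apply, ← zpow_add]
        simp
      refine ⟨(hI.coxeterElement ^ (-m)) φ, ⟨?_, hzpow _ hφO⟩, hinv⟩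
      by_contra h
      rw [← hI.zpow_apply_mem_positiveRoots_iff hx hm (hroot _ (hzpow _ hφO)), hinv] at h
      exact hφ ⟨h, hφO⟩
  have hsub : hI.positivePart i ⊆ O := Set.inter_subset_right
  have hdiff := Set.ncard_sdiff_add_ncard_of_subset hsub hfin
  rw [← himage, Set.ncard_image_of_injective _ (hI.coxeterElement ^ m).injective, hcard] at hdiff
  omega

lemma positiveRoots_eq_iUnion_positivePart (hx : b.IsPerronVector x η) :
    b.positiveRoots = ⋃ i : b.support, hI.positivePart i := by
  ext φ
  refine ⟨fun hφ ↦ ?_, fun hφ ↦ ?_⟩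
  · obtain ⟨i, k, hk⟩ := hI.exists_zpow_signedSimpleRoot_eq hx hφ
    exact Set.mem_iUnion.mpr ⟨i, hφ, hI.mem_orbit_zpowers_iff.mpr ⟨k, hk⟩⟩
  · obtain ⟨i, hi⟩ := Set.mem_iUnion.mp hφ
    exact hi.1

lemma pairwise_disjoint_positivePart (hx : b.IsPerronVector x η) :
    Pairwise fun i j : b.support ↦ Disjoint (hI.positivePart i) (hI.positivePart j) := by
  intro i j hij
  obtain ⟨m, hm⟩ := hI.exists_zpow_eq_neg_one hx
  refine Set.disjoint_left.mpr fun φ hi hj ↦ hij ?_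
  obtain ⟨k, hk⟩ := hI.mem_orbit_zpowers_iff.mp hi.2
  obtain ⟨l, hl⟩ := hI.mem_orbit_zpowers_iff.mp hj.2
  refine (hI.eq_and_zpow_eq_one_of_zpow_signedSimpleRoot_eq hx hm (k := -l + k) ?_).1
  rw [zpow_add, LinearEquiv.mul_apply, hk, ← hl, ← LinearEquiv.mul_apply, ← zpow_add]
  simp

end RootPairing.Base.IsOrthogonalPartition

theorem theorem1p9 {𝔤 : Type*} [LieRing 𝔤] [LieAlgebra ℂ 𝔤] [FiniteDimensional ℂ 𝔤]
    [LieAlgebra.IsSimple ℂ 𝔤] (𝔥 : LieSubalgebra ℂ 𝔤) [𝔥.IsCartanSubalgebra]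
    (b : (LieAlgebra.IsKilling.rootSystem 𝔥).Base) (hADE : b.cartanMatrix.IsSimplyLaced)
    (ψ : 𝔥.root) (hψ : b.IsHighestRoot ψ)
    (I₁ I₂ : Set b.support) (hI : b.IsOrthogonalPartition ψ I₁ I₂) :
    (∀ i : b.support, ((hI.positivePart i).ncard : ℚ) = (hI.coxeterNumber : ℚ) / 2) ∧
      b.positiveRoots = ⋃ i : b.support, hI.positivePart i ∧
      Pairwise fun i j : b.support ↦ Disjoint (hI.positivePart i) (hI.positivePart j) := by
  obtain ⟨x, η, hx⟩ := RootPairing.Base.exists_isPerronVector hADE hψ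
  refine ⟨fun i ↦ ?_, hI.positiveRoots_eq_iUnion_positivePart hx,
    hI.pairwise_disjoint_positivePart hx⟩
  rw [← hI.two_mul_ncard_positivePart hx i]
  push_cast
  ring
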